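/- Let $n\ge 0$ and let $\langle\!\langle z,w\rangle\!\rangle = z_1\overline{w_1}+\cdots+z_n\overline{w_n}-z_{n+1}\overline{w_{n+1}}$ on $\mathbb{C}^{n+1}$. Let complex hyperbolic space $\mathbb{H}^n_{\mathbb{C}}\subset\mathbb{C}^n$ be the image of $\{z : \langle\!\langle z,z\rangle\!\rangle<0\}$ under $(z_1,\dots,z_{n+1})\mapsto(z_1/z_{n+1},\dots,z_n/z_{n+1})$ (this is the open unit ball), with the Bergman metric $$ds^2=\frac{-4}{\langle\!\langle z,z\rangle\!\rangle^2}\det\begin{bmatrix}\langle\!\langle z,z\rangle\!\rangle&\langle\!\langle dz,z\rangle\!\rangle\\ \langle\!\langle z,dz\rangle\!\rangle&\langle\!\langle dz,dz\rangle\!\rangle\end{bmatrix},$$ where $z$ is lifted to $(z,1)$ and $dz$ to $(dz,0)$; write $g$ for the corresponding real inner product on each tangent space $T_z\mathbb{H}^n_{\mathbb{C}}=\mathbb{C}^n$, and $J$ for multiplication by $i$. This metric has a Levi-Civita connection, and for it the following holds for the sectional curvature $K(S)=\dfrac{g(R(u,v)v,u)}{g(u,u)g(v,v)-g(u,v)^2}$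 of real tangent planes $S=\operatorname{span}_{\mathbb{R}}(u,v)$, where $R(X,Y)Z=\nabla_X\nabla_YZ-\nabla_Y\nabla_XZ-\nabla_{[X,Y]}Z$. 1. For every $z\in\mathbb{H}^n_{\mathbb{C}}$ and every real $2$-dimensional subspace $S\subset T_z\mathbb{H}^n_{\mathbb{C}}$, $K(S)$ is well defined (independent of the basis $u,v$ of $S$ and of the smooth vector fields extending the vectors) and $-1\le K(S)\le-\tfrac14$. Moreover $K(S)=-1$ if and only if $S$ is the direction of a complex projective line ($JS\subseteq S$), and $K(S)=-\tfrac14$ if and only if $S$ is the direction of a totally real plane ($JS$ is $g$-orthogonal to $S$). 2. If $n\ge2$, then at every point $z\in\mathbb{H}^n_{\mathbb{C}}$ there are tangent planes of both kinds, so that both values $-1$ and $-\tfrac14$ are attained at every point; in particular the sectional curvature of $\mathbb{H}^n_{\mathbb{C}}$ is not constant. -/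

import Mathlib

open scoped Manifold ContDiff

noncomputable section

/-! ### Curvature on an open subset of a real vector space

The Riemannian manifold is an open subset `U` of a real normed space `E` with a metric
`g : E → E → E → ℝ`, where `g z u v` is the inner product of `u, v ∈ T_z U = E`.  Vector fields are
maps `E → E`, and only their behaviour on `U` matters.  A connection is a covariant derivative on
`U` in the sense of Mathlib: `cov Y z (X z)` is `(∇_X Y)(z)`. -/

section Curvature

variable {E : Type*} [NormedAddCommGroup E] [NormedSpace ℝ E]

/-- The type of (candidate) affine connections on the tangent bundle of `E`. -/
abbrev Connection (E : Type*) [NormedAddCommGroup E] [NormedSpace ℝ E] : Type _ :=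
  (Π x : E, TangentSpace 𝓘(ℝ, E) x) →
    (Π x : E, TangentSpace 𝓘(ℝ, E) x →L[ℝ] TangentSpace 𝓘(ℝ, E) x)

/-- The vector field `∇_X Y`. -/
def Connection.nabla (cov : Connection E) (X Y : E → E) : E → E :=
  fun z => cov Y z (X z)

/-- `cov` is a Levi-Civita connection of the metric `g` on `U`: an affine connection on `U` that
preserves the metric and is torsion-free. -/
structure IsLeviCivitaOn (U : Set E) (g : E → E → E → ℝ) (cov : Connection E) : Prop where
  isCovariantDerivativeOn : IsCovariantDerivativeOn (I := 𝓘(ℝ, E)) E cov U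
  metric : ∀ (X Y Z : E → E) (z : E), z ∈ U →
    DifferentiableAt ℝ X z → DifferentiableAt ℝ Y z → DifferentiableAt ℝ Z z →
    fderiv ℝ (fun x => g x (Y x) (Z x)) z (X z) =
      g z (cov.nabla X Y z) (Z z) + g z (Y z) (cov.nabla X Z z)
  torsion_free : ∀ (X Y : E → E) (z : E), z ∈ U →
    DifferentiableAt ℝ X z → DifferentiableAt ℝ Y z →
    cov.nabla X Y z - cov.nabla Y X z = VectorField.lieBracket ℝ X Y z

/-- The Riemann curvature `R(X,Y)Z = ∇_X ∇_Y Z - ∇_Y ∇_X Z - ∇_{[X,Y]} Z`. -/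
def Connection.riemann (cov : Connection E) (X Y Z : E → E) : E → E :=
  fun z => cov.nabla X (cov.nabla Y Z) z - cov.nabla Y (cov.nabla X Z) z
    - cov.nabla (VectorField.lieBracket ℝ X Y) Z z

/-- `κ` is the sectional curvature at `z ∈ U` of the tangent plane `S`: for all linearly independent
`u, v ∈ S`,
`κ = ⟨R(u,v)v, u⟩ / (⟨u,u⟩⟨v,v⟩ - ⟨u,v⟩²)`,
where `R(u,v)v` is computed with any smooth vector fields `X`, `Y`, `Z` on `U` that take the values
`u`, `v`, `v` at `z`. -/
def IsSectionalCurvature (U : Set E) (g : E → E → E → ℝ) (cov : Connection E) (z : E)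
    (S : Submodule ℝ E) (κ : ℝ) : Prop :=
  ∀ u ∈ S, ∀ v ∈ S, LinearIndependent ℝ ![u, v] →
    ∀ X Y Z : E → E, ContDiffOn ℝ ∞ X U → ContDiffOn ℝ ∞ Y U → ContDiffOn ℝ ∞ Z U →
      X z = u → Y z = v → Z z = v →
      g z (cov.riemann X Y Z z) u / (g z u u * g z v v - g z u v ^ 2) = κ

end Curvature

/-! ### Complex hyperbolic space: the unit ball model with the Bergman metric -/

section ComplexHyperbolic

variable {n : ℕ}

/-- The Hermitian form of signature `(n, 1)` on `ℂⁿ⁺¹`: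
`⟪⟪z, w⟫⟫ = z₁ w̄₁ + ⋯ + zₙ w̄ₙ - zₙ₊₁ w̄ₙ₊₁`. -/
def hermForm (z w : Fin (n + 1) → ℂ) : ℂ :=
  ∑ i : Fin n, z i.castSucc * starRingEnd ℂ (w i.castSucc)
    - z (Fin.last n) * starRingEnd ℂ (w (Fin.last n))

/-- The projection `(z₁, …, zₙ₊₁) ↦ (z₁ / zₙ₊₁, …, zₙ / zₙ₊₁)`, used where `zₙ₊₁ ≠ 0`. -/
def projMap (z : Fin (n + 1) → ℂ) : EuclideanSpace ℂ (Fin n) :=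
  WithLp.toLp 2 fun i => z i.castSucc / z (Fin.last n)

/-- Complex hyperbolic space: the image under the projection of the set of negative vectors
(on which the last coordinate does not vanish).  It is the open unit ball of `ℂⁿ`. -/
def complexHyperbolicSpace (n : ℕ) : Set (EuclideanSpace ℂ (Fin n)) :=
  projMap '' {z : Fin (n + 1) → ℂ | (hermForm z z).re < 0}

/-- The vector `(z₁, …, zₙ, t)` of `ℂⁿ⁺¹`. -/
def affineLift (z : EuclideanSpace ℂ (Fin n)) (t : ℂ) : Fin (n + 1) → ℂ :=
  Fin.snoc (α := fun _ => ℂ) (fun i => z i) t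

/-- The Bergman metric, i.e. the real inner product on the tangent space `ℂⁿ` at the point `z`
obtained by polarization from
`ds² = -4 / ⟪⟪z,z⟫⟫² * det [⟪⟪z,z⟫⟫, ⟪⟪dz,z⟫⟫; ⟪⟪z,dz⟫⟫, ⟪⟪dz,dz⟫⟫]`,
where `z` stands for `(z, 1)` and `dz` for `(dz, 0)`. -/
def bergmanMetric (z u v : EuclideanSpace ℂ (Fin n)) : ℝ :=
  -4 / (hermForm (affineLift z 1) (affineLift z 1)).re ^ 2 *
    (Matrix.det !![hermForm (affineLift z 1) (affineLift z 1), hermForm (affineLift u 0) (affineLift z 1);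
      hermForm (affineLift z 1) (affineLift v 0), hermForm (affineLift u 0) (affineLift v 0)]).re

/-- A real subspace of the tangent space is complex if it is invariant under the complex structure
`J = i •`.  The two-dimensional ones are the tangent planes of complex (projective) lines. -/
def IsComplexSubspace (S : Submodule ℝ (EuclideanSpace ℂ (Fin n))) : Prop :=
  ∀ u ∈ S, Complex.I • u ∈ S

/-- A real subspace `S` of the tangent space at `z` is totally real if `J S` is orthogonal to `S`
for the Bergman metric. -/
def IsTotallyReal (z : EuclideanSpace ℂ (Fin n))
    (S : Submodule ℝ (EuclideanSpace ℂ (Fin n))) : Prop :=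
  ∀ u ∈ S, ∀ v ∈ S, bergmanMetric z u (Complex.I • v) = 0

end ComplexHyperbolic

end

/-! Put `ρ = 1 - ‖z‖²`. Expanding the determinant gives `g = 4 Re H`, where `H = bergmanHerm` is a
positive definite Hermitian form on each tangent space of the ball. The complex bilinear symmetric
`Γ = bergmanGamma` satisfies the product rule for `H`, so `DY(X) + Γ(X, Y)` is a Levi-Civita
connection; by uniqueness any other one has the same curvature (`IsLeviCivitaOn.riemann_eq`).

Differentiating once more (`riemann_bergmanConnection`) gives `R(X,Y)Z = (H(Y,X) - H(X,Y)) Z +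
H(Z,X) Y - H(Z,Y) X`. With `b = Im H(u,v)` and `D = H(u,u) H(v,v) - (Re H(u,v))²` this yields `K =
-(1/4) (1 + 3 b² / D)`. Cauchy-Schwarz for `H` says `0 ≤ b² ≤ D`, whence the pinching. Equality `b²
= D` means that `u`, `v` are complex dependent, so the plane is a complex line; `b = 0` means that
`Ju`, `Jv` are orthogonal to the plane. In dimension at least two, an `H`-orthogonal pair provides
planes of both kinds. -/

noncomputable section

/-! ### Uniqueness of the Levi-Civita connection -/

section LeviCivita

variable {E : Type*} [NormedAddCommGroup E] [NormedSpace ℝ E]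

theorem mdifferentiableAt_section_tangentSpace_iff
    (σ : Π x : E, TangentSpace 𝓘(ℝ, E) x) (x : E) :
    MDiffAt (T% σ) x ↔ DifferentiableAt ℝ (σ : E → E) x := by
  rw [mdifferentiableAt_section]
  simp only [trivializationAt_model_space_apply]
  exact mdifferentiableAt_iff_differentiableAt

/-- A Levi-Civita connection of a definite metric is unique. -/
theorem IsLeviCivitaOn.nabla_eq {U : Set E} {g : E → E → E → ℝ} {cov cov' : Connection E}
    (h : IsLeviCivitaOn U g cov) (h' : IsLeviCivitaOn U g cov')
    (hsymm : ∀ z u v, g z u v = g z v u)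
    (hsub : ∀ z u v w, g z (u - v) w = g z u w - g z v w)
    (hdef : ∀ z ∈ U, ∀ u, g z u u = 0 → u = 0)
    (X : E → E) {Y : E → E} {z : E} (hz : z ∈ U) (hY : DifferentiableAt ℝ Y z) :
    cov.nabla X Y z = cov'.nabla X Y z := by
  -- Christoffel symbols at `z`: the connection on constant fields, whose Lie brackets vanish.
  let T (c : Connection E) (a b : E) : E := c (fun _ => b) z a
  have hT (c : Connection E) (hc : IsLeviCivitaOn U g c) (a b : E) : T c a b = T c b a := by
    have := hc.torsion_free (fun _ => a) (fun _ => b) z hz (by fun_prop) (by fun_prop)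
    simp only [VectorField.lieBracket, fderiv_fun_const, Pi.zero_apply,
      zero_apply, sub_zero] at this
    exact sub_eq_zero.1 this
  have hg (c : Connection E) (hc : IsLeviCivitaOn U g c) (a b d : E) :
      fderiv ℝ (fun x => g x b d) z a = g z (T c a b) d + g z (T c a d) b := by
    rw [hsymm z (T c a d) b]
    exact hc.metric (fun _ => a) (fun _ => b) (fun _ => d) z hz (by fun_prop) (by fun_prop)
      (by fun_prop)
  let D (a b : E) : E := T cov a b - T cov' a b
  have hD (a b : E) : D a b = D b a := by simp only [D, hT cov h a b, hT cov' h' a b]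
  have hDg (a b d : E) : g z (D a b) d = - g z (D a d) b := by
    have h1 := hg cov h a b d
    have h2 := hg cov' h' a b d
    simp only [D, hsub]
    linarith
  -- A trilinear expression symmetric in its first two slots and skew in its last two vanishes.
  have hD0 (a b d : E) : g z (D a b) d = 0 := by
    have h1 := hDg a b d
    have h2 := hDg b a d
    have h3 := hDg d a b
    rw [hD b a] at h2
    rw [hD d a, hD d b] at h3
    linarith
  have hT' (a b : E) : T cov a b = T cov' a b := sub_eq_zero.1 (hdef z hz _ (hD0 a b _))
  -- Zero torsion against the constant field `X z` recovers `∇_X Y` from the Christoffel symbols.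
  have hc (c : Connection E) (hc : IsLeviCivitaOn U g c) :
      c.nabla X Y z = fderiv ℝ Y z (X z) + T c (X z) (Y z) := by
    have := hc.torsion_free (fun _ => X z) Y z hz (by fun_prop) hY
    simp only [VectorField.lieBracket, fderiv_fun_const, Pi.zero_apply,
      zero_apply, sub_zero] at this
    rw [← this, hT c hc]
    exact (sub_add_cancel (c Y z (X z)) (T c (Y z) (X z))).symm
  rw [hc cov h, hc cov' h', hT']

end LeviCivita

/-! ### The Hermitian form, its Christoffel symbols and their derivatives -/

section Bergman

/-- `1 - ‖z‖²`, as a complex number. -/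
def bergmanRho {E : Type*} [NormedAddCommGroup E] [InnerProductSpace ℂ E] (z : E) : ℂ :=
  1 - inner ℂ z z

variable {E : Type*} [NormedAddCommGroup E] [InnerProductSpace ℂ E]

/-- One quarter of the Hermitian form on the tangent space whose real part is the Bergman metric. -/
def bergmanHerm (z u v : E) : ℂ :=
  inner ℂ v u / bergmanRho z + inner ℂ z u * inner ℂ v z / bergmanRho z ^ 2

/-- The Christoffel symbols of the Bergman metric. -/
def bergmanGamma (z u v : E) : E :=
  (inner ℂ z u / bergmanRho z) • v + (inner ℂ z v / bergmanRho z) • u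

theorem bergmanGamma_comm (z u v : E) : bergmanGamma z u v = bergmanGamma z v u :=
  add_comm _ _

theorem bergmanGamma_add_left (z u v w : E) :
    bergmanGamma z (u + v) w = bergmanGamma z u w + bergmanGamma z v w := by
  simp only [bergmanGamma, inner_add_right]
  module

theorem bergmanGamma_add_right (z u v w : E) :
    bergmanGamma z u (v + w) = bergmanGamma z u v + bergmanGamma z u w := by
  simp only [bergmanGamma, inner_add_right]
  module

theorem bergmanGamma_smul_left (z u v : E) (c : ℂ) :
    bergmanGamma z (c • u) v = c • bergmanGamma z u v := by
  simp only [bergmanGamma, inner_smul_right]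
  module

theorem bergmanGamma_smul_right (z u v : E) (c : ℂ) :
    bergmanGamma z u (c • v) = c • bergmanGamma z u v := by
  simp only [bergmanGamma, inner_smul_right]
  module

theorem conj_bergmanRho (z : E) : starRingEnd ℂ (bergmanRho z) = bergmanRho z := by
  simp only [bergmanRho, map_sub, map_one, inner_conj_symm]

theorem bergmanRho_eq (z : E) : bergmanRho z = ((1 - ‖z‖ ^ 2 : ℝ) : ℂ) := by
  simp [bergmanRho, inner_self_eq_norm_sq_to_K]

theorem bergmanRho_ne_zero {z : E} (hz : z ∈ Metric.ball (0 : E) 1) : bergmanRho z ≠ 0 := by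
  rw [mem_ball_zero_iff] at hz
  rw [bergmanRho_eq, Complex.ofReal_ne_zero]
  nlinarith [norm_nonneg z]

theorem conj_bergmanHerm (z u v : E) :
    starRingEnd ℂ (bergmanHerm z u v) = bergmanHerm z v u := by
  simp only [bergmanHerm, map_add, map_div₀, map_mul, map_pow, conj_bergmanRho, inner_conj_symm]
  ring

theorem bergmanHerm_sub_left (z u v w : E) :
    bergmanHerm z (u - v) w = bergmanHerm z u w - bergmanHerm z v w := by
  simp only [bergmanHerm, inner_sub_right]
  ring

theorem bergmanHerm_add_left (z u v w : E) :
    bergmanHerm z (u + v) w = bergmanHerm z u w + bergmanHerm z v w := by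
  simp only [bergmanHerm, inner_add_right]
  ring

theorem bergmanHerm_smul_left (z u v : E) (c : ℂ) :
    bergmanHerm z (c • u) v = c * bergmanHerm z u v := by
  simp only [bergmanHerm, inner_smul_right]
  ring

theorem bergmanHerm_smul_right (z u v : E) (c : ℂ) :
    bergmanHerm z u (c • v) = starRingEnd ℂ c * bergmanHerm z u v := by
  simp only [bergmanHerm, inner_smul_left]
  ring

theorem bergmanHerm_self (z u : E) :
    bergmanHerm z u u =
      ((‖u‖ ^ 2 / (1 - ‖z‖ ^ 2) + ‖inner ℂ z u‖ ^ 2 / (1 - ‖z‖ ^ 2) ^ 2 : ℝ) : ℂ) := by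
  rw [bergmanHerm, bergmanRho_eq, ← inner_conj_symm u z, Complex.mul_conj',
    inner_self_eq_norm_sq_to_K]
  push_cast
  rfl

theorem bergmanHerm_self_im (z u : E) : (bergmanHerm z u u).im = 0 := by
  rw [bergmanHerm_self, Complex.ofReal_im]

theorem bergmanHerm_self_pos {z u : E} (hz : z ∈ Metric.ball (0 : E) 1) (hu : u ≠ 0) :
    0 < (bergmanHerm z u u).re := by
  rw [mem_ball_zero_iff] at hz
  have hρ : 0 < 1 - ‖z‖ ^ 2 := by nlinarith [norm_nonneg z]
  have := norm_pos_iff.2 hu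
  rw [bergmanHerm_self, Complex.ofReal_re]
  positivity

theorem bergmanHerm_self_nonneg {z : E} (hz : z ∈ Metric.ball (0 : E) 1) (u : E) :
    0 ≤ (bergmanHerm z u u).re := by
  rcases eq_or_ne u 0 with rfl | hu
  · simp [bergmanHerm]
  · exact (bergmanHerm_self_pos hz hu).le

/-- The complex Lagrange identity. -/
theorem bergmanHerm_gram (z u v : E) :
    (bergmanHerm z v v).re *
        ((bergmanHerm z u u).re * (bergmanHerm z v v).re - (bergmanHerm z u v).re ^ 2
          - (bergmanHerm z u v).im ^ 2) =
      (bergmanHerm z (bergmanHerm z v v • u - bergmanHerm z u v • v)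
        (bergmanHerm z v v • u - bergmanHerm z u v • v)).re := by
  have hu := bergmanHerm_self_im z u
  have hv := bergmanHerm_self_im z v
  have hr (u v w : E) : bergmanHerm z w (u - v) = bergmanHerm z w u - bergmanHerm z w v := by
    simp only [bergmanHerm, inner_sub_left]
    ring
  simp only [bergmanHerm_sub_left, hr, bergmanHerm_smul_left, bergmanHerm_smul_right]
  rw [← conj_bergmanHerm z u v]
  simp only [Complex.mul_re, Complex.mul_im, Complex.sub_re, Complex.sub_im, Complex.conj_re,
    Complex.conj_im, hu, hv]
  ring

variable [NormedSpace ℝ E]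

theorem hasDerivAt_bergmanRho {w : ℝ → E} {w' : E} {t : ℝ} (hw : HasDerivAt w w' t) :
    HasDerivAt (fun s => bergmanRho (w s)) (-(inner ℂ (w t) w' + inner ℂ w' (w t))) t := by
  simpa only [bergmanRho] using (hw.inner ℂ hw).const_sub 1

/-- Metric compatibility along a curve. The terms complex linear in `w'` form the `bergmanGamma`
correction of the first slot, the conjugate linear ones that of the second. -/
theorem hasDerivAt_bergmanHerm {w u v : ℝ → E} {w' u' v' : E} {t : ℝ}
    (hw : HasDerivAt w w' t) (hu : HasDerivAt u u' t) (hv : HasDerivAt v v' t)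
    (h : bergmanRho (w t) ≠ 0) :
    HasDerivAt (fun s => bergmanHerm (w s) (u s) (v s))
      (bergmanHerm (w t) (u' + bergmanGamma (w t) w' (u t)) (v t) +
        bergmanHerm (w t) (u t) (v' + bergmanGamma (w t) w' (v t))) t := by
  have h1 := ((hv.inner ℂ hu).div (hasDerivAt_bergmanRho hw) h).add
    (((hw.inner ℂ hu).mul (hv.inner ℂ hw)).div ((hasDerivAt_bergmanRho hw).pow 2)
      (pow_ne_zero 2 h))
  refine h1.congr_deriv ?_
  simp only [bergmanHerm, bergmanGamma, inner_add_left, inner_add_right, inner_smul_left,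
    inner_smul_right, map_div₀, conj_bergmanRho, inner_conj_symm, Pi.pow_apply, Pi.mul_apply]
  field_simp
  ring

theorem DifferentiableAt.bergmanRho {F : Type*} [NormedAddCommGroup F] [NormedSpace ℝ F]
    {w : F → E} {x : F} (hw : DifferentiableAt ℝ w x) :
    DifferentiableAt ℝ (fun y => bergmanRho (w y)) x := by
  simp only [_root_.bergmanRho]
  exact (hw.inner ℂ hw).const_sub 1

theorem DifferentiableAt.bergmanHerm {F : Type*} [NormedAddCommGroup F] [NormedSpace ℝ F]
    {w u v : F → E} {x : F} (hw : DifferentiableAt ℝ w x) (hu : DifferentiableAt ℝ u x)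
    (hv : DifferentiableAt ℝ v x) (h : _root_.bergmanRho (w x) ≠ 0) :
    DifferentiableAt ℝ (fun y => bergmanHerm (w y) (u y) (v y)) x := by
  simp only [_root_.bergmanHerm, div_eq_mul_inv]
  exact ((hv.inner ℂ hu).fun_mul (hw.bergmanRho.fun_inv h)).fun_add
    (((hw.inner ℂ hu).fun_mul (hv.inner ℂ hw)).fun_mul ((hw.bergmanRho.fun_pow 2).fun_inv (pow_ne_zero 2 h)))

variable [IsScalarTower ℝ ℂ E]

/-- Each scalar in the last two terms equals `H(x, w') + ⟨w, x⟩⟨w, w'⟩ / ρ²` with `x = u` or `x =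
v`. The `H` part produces the curvature tensor. -/
theorem hasDerivAt_bergmanGamma {w u v : ℝ → E} {w' u' v' : E} {t : ℝ}
    (hw : HasDerivAt w w' t) (hu : HasDerivAt u u' t) (hv : HasDerivAt v v' t)
    (h : bergmanRho (w t) ≠ 0) :
    HasDerivAt (fun s => bergmanGamma (w s) (u s) (v s))
      (bergmanGamma (w t) u' (v t) + bergmanGamma (w t) (u t) v' +
        (inner ℂ w' (u t) / bergmanRho (w t) + inner ℂ (w t) (u t) *
          (inner ℂ (w t) w' + inner ℂ w' (w t)) / bergmanRho (w t) ^ 2) • v t +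
        (inner ℂ w' (v t) / bergmanRho (w t) + inner ℂ (w t) (v t) *
          (inner ℂ (w t) w' + inner ℂ w' (w t)) / bergmanRho (w t) ^ 2) • u t) t := by
  have h1 := (((hw.inner ℂ hu).div (hasDerivAt_bergmanRho hw) h).smul hv).add
    (((hw.inner ℂ hv).div (hasDerivAt_bergmanRho hw) h).smul hu)
  refine h1.congr_deriv ?_
  simp only [bergmanGamma, Pi.div_apply]
  match_scalars <;> (field_simp; try ring)

theorem DifferentiableAt.bergmanGamma {F : Type*} [NormedAddCommGroup F] [NormedSpace ℝ F]
    {w u v : F → E} {x : F} (hw : DifferentiableAt ℝ w x) (hu : DifferentiableAt ℝ u x)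
    (hv : DifferentiableAt ℝ v x) (h : _root_.bergmanRho (w x) ≠ 0) :
    DifferentiableAt ℝ (fun y => bergmanGamma (w y) (u y) (v y)) x := by
  simp only [_root_.bergmanGamma, div_eq_mul_inv]
  exact (((hw.inner ℂ hu).fun_mul (hw.bergmanRho.fun_inv h)).fun_smul hv).fun_add
    (((hw.inner ℂ hv).fun_mul (hw.bergmanRho.fun_inv h)).fun_smul hu)

end Bergman

/-! ### The Levi-Civita connection and its curvature tensor -/

section Connection

/-- Restriction to a line turns the formulas along curves into formulas for `fderiv`. -/
theorem DifferentiableAt.hasDerivAt_comp_add_smul {E F : Type*} [NormedAddCommGroup E]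
    [NormedSpace ℝ E] [NormedAddCommGroup F]
    [NormedSpace ℝ F] {f : E → F} {z : E} (hf : DifferentiableAt ℝ f z) (a : E) :
    HasDerivAt (fun t : ℝ => f (z + t • a)) (fderiv ℝ f z a) 0 := by
  have hl : HasDerivAt (fun t : ℝ => z + t • a) a 0 := by
    simpa using ((hasDerivAt_id (0 : ℝ)).smul_const a).const_add z
  have hf' : HasFDerivAt f (fderiv ℝ f z) (z + (0 : ℝ) • a) := by
    simpa using hf.hasFDerivAt
  exact hf'.comp_hasDerivAt (0 : ℝ) hl

variable {E : Type*} [NormedAddCommGroup E] [InnerProductSpace ℂ E] [NormedSpace ℝ E]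

theorem bergmanConnection_add {Y Y' : E → E} {z : E} (hY : DifferentiableAt ℝ Y z)
    (hY' : DifferentiableAt ℝ Y' z) (u : E) :
    fderiv ℝ (Y + Y') z u + bergmanGamma z u (Y z + Y' z) =
      (fderiv ℝ Y z u + bergmanGamma z u (Y z)) + (fderiv ℝ Y' z u + bergmanGamma z u (Y' z)) := by
  rw [fderiv_add hY hY', bergmanGamma_add_right, add_apply]
  abel

theorem fderiv_bergmanHerm {Y Z : E → E} {z : E} (hz : z ∈ Metric.ball (0 : E) 1)
    (hY : DifferentiableAt ℝ Y z) (hZ : DifferentiableAt ℝ Z z) (a : E) :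
    fderiv ℝ (fun x => bergmanHerm x (Y x) (Z x)) z a =
      bergmanHerm z (fderiv ℝ Y z a + bergmanGamma z a (Y z)) (Z z) +
        bergmanHerm z (Y z) (fderiv ℝ Z z a + bergmanGamma z a (Z z)) := by
  have hρ := bergmanRho_ne_zero hz
  have hd := (differentiableAt_id.bergmanHerm hY hZ hρ).hasDerivAt_comp_add_smul a
  have h := hasDerivAt_bergmanHerm
    ((differentiableAt_id (𝕜 := ℝ) (x := z)).hasDerivAt_comp_add_smul a)
    (hY.hasDerivAt_comp_add_smul a) (hZ.hasDerivAt_comp_add_smul a) (by simpa using hρ)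
  simpa using hd.unique h

variable [IsScalarTower ℝ ℂ E]

/-- The map `u ↦ bergmanGamma z u v` as a continuous real-linear map. -/
def bergmanGammaCLM (z v : E) : E →L[ℝ] E where
  toFun u := bergmanGamma z u v
  map_add' u u' := bergmanGamma_add_left z u u' v
  map_smul' r u := by
    rw [← algebraMap_smul ℂ r u, bergmanGamma_smul_left, algebraMap_smul]
    rfl
  cont := by
    unfold bergmanGamma
    fun_prop

/-- The Levi-Civita connection of the Bergman metric. -/
def bergmanConnection (E : Type*) [NormedAddCommGroup E] [InnerProductSpace ℂ E] [NormedSpace ℝ E]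
    [IsScalarTower ℝ ℂ E] : Connection E :=
  fun Y z => (fderiv ℝ (Y : E → E) z + bergmanGammaCLM z (Y z) : E →L[ℝ] E)

theorem bergmanConnection_nabla (X Y : E → E) (z : E) :
    (bergmanConnection E).nabla X Y z = fderiv ℝ Y z (X z) + bergmanGamma z (X z) (Y z) := rfl

theorem bergmanConnection_smul {f : E → ℝ} {Y : E → E} {z : E} (hf : DifferentiableAt ℝ f z)
    (hY : DifferentiableAt ℝ Y z) (u : E) :
    fderiv ℝ (f • Y) z u + bergmanGamma z u (f z • Y z) =
      f z • (fderiv ℝ Y z u + bergmanGamma z u (Y z)) + fderiv ℝ f z u • Y z := by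
  rw [fderiv_smul hf hY, ← algebraMap_smul ℂ (f z) (Y z), bergmanGamma_smul_right,
    algebraMap_smul]
  simp only [add_apply, smul_apply, ContinuousLinearMap.smulRight_apply, smul_add]
  abel

theorem isCovariantDerivativeOn_bergmanConnection (U : Set E) :
    IsCovariantDerivativeOn (I := 𝓘(ℝ, E)) E (bergmanConnection E) U where
  add {σ σ' x} hσ hσ' _ := by
    rw [mdifferentiableAt_section_tangentSpace_iff] at hσ hσ'
    exact ContinuousLinearMap.ext fun u => bergmanConnection_add hσ hσ' u
  leibniz {σ g x} hσ hg _ := by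
    rw [mdifferentiableAt_section_tangentSpace_iff] at hσ
    rw [mdifferentiableAt_iff_differentiableAt] at hg
    have hm : mvfderiv 𝓘(ℝ, E) g x = fderiv ℝ g x := by
      rw [mvfderiv, mfderiv_eq_fderiv]
      rfl
    rw [hm]
    exact ContinuousLinearMap.ext fun u => bergmanConnection_smul hg hσ u

theorem isLeviCivitaOn_bergmanConnection :
    IsLeviCivitaOn (Metric.ball (0 : E) 1) (fun z u v => 4 * (bergmanHerm z u v).re)
      (bergmanConnection E) where
  isCovariantDerivativeOn := isCovariantDerivativeOn_bergmanConnection _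
  metric X Y Z z hz _ hY hZ := by
    have hd : DifferentiableAt ℝ (fun x => bergmanHerm x (Y x) (Z x)) z :=
      differentiableAt_id.bergmanHerm hY hZ (bergmanRho_ne_zero hz)
    have h := ((Complex.reCLM.hasFDerivAt.comp z hd.hasFDerivAt).const_mul 4).fderiv
    change fderiv ℝ (fun x => 4 * (bergmanHerm x (Y x) (Z x)).re) z = _ at h
    rw [h, bergmanConnection_nabla, bergmanConnection_nabla, smul_apply,
      ContinuousLinearMap.comp_apply, fderiv_bergmanHerm hz hY hZ, Complex.reCLM_apply,
      Complex.add_re, smul_eq_mul, mul_add]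
  torsion_free X Y z _ _ _ := by
    rw [bergmanConnection_nabla, bergmanConnection_nabla, bergmanGamma_comm z (X z),
      VectorField.lieBracket]
    abel

theorem fderiv_bergmanConnection_nabla {Y Z : E → E} {z : E} (hz : z ∈ Metric.ball (0 : E) 1)
    (hY : DifferentiableAt ℝ Y z) (hZ : ContDiffAt ℝ 2 Z z) (a : E) :
    DifferentiableAt ℝ ((bergmanConnection E).nabla Y Z) z ∧
    fderiv ℝ ((bergmanConnection E).nabla Y Z) z a =
      fderiv ℝ (fderiv ℝ Z) z a (Y z) + fderiv ℝ Z z (fderiv ℝ Y z a) +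
      (bergmanGamma z (fderiv ℝ Y z a) (Z z) + bergmanGamma z (Y z) (fderiv ℝ Z z a) +
        (inner ℂ a (Y z) / bergmanRho z + inner ℂ z (Y z) *
          (inner ℂ z a + inner ℂ a z) / bergmanRho z ^ 2) • Z z +
        (inner ℂ a (Z z) / bergmanRho z + inner ℂ z (Z z) *
          (inner ℂ z a + inner ℂ a z) / bergmanRho z ^ 2) • Y z) := by
  have hρ := bergmanRho_ne_zero hz
  have hZ1 : DifferentiableAt ℝ Z z := hZ.differentiableAt (by norm_num)
  have hZ2 : DifferentiableAt ℝ (fderiv ℝ Z) z :=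
    (hZ.fderiv_right (m := 1) (by norm_num)).differentiableAt (by norm_num)
  have hd : DifferentiableAt ℝ ((bergmanConnection E).nabla Y Z) z :=
    (hZ2.clm_apply hY).add (differentiableAt_id.bergmanGamma hY hZ1 hρ)
  refine ⟨hd, (hd.hasDerivAt_comp_add_smul a).unique ?_⟩
  have h := ((hZ2.hasDerivAt_comp_add_smul a).clm_apply (hY.hasDerivAt_comp_add_smul a)).add
    (hasDerivAt_bergmanGamma
    ((differentiableAt_id (𝕜 := ℝ) (x := z)).hasDerivAt_comp_add_smul a)
    (hY.hasDerivAt_comp_add_smul a) (hZ1.hasDerivAt_comp_add_smul a) (by simpa using hρ))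
  refine h.congr_deriv ?_
  simp

/-- The curvature tensor of the Bergman metric. -/
theorem riemann_bergmanConnection {X Y Z : E → E} {z : E} (hz : z ∈ Metric.ball (0 : E) 1)
    (hX : DifferentiableAt ℝ X z) (hY : DifferentiableAt ℝ Y z) (hZ : ContDiffAt ℝ 2 Z z) :
    (bergmanConnection E).riemann X Y Z z =
      (bergmanHerm z (Y z) (X z) - bergmanHerm z (X z) (Y z)) • Z z +
        bergmanHerm z (Z z) (X z) • Y z - bergmanHerm z (Z z) (Y z) • X z := by
  have hs : fderiv ℝ (fderiv ℝ Z) z (X z) (Y z) = fderiv ℝ (fderiv ℝ Z) z (Y z) (X z) :=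
    hZ.isSymmSndFDerivAt (by simp) _ _
  have hρ := bergmanRho_ne_zero hz
  rw [Connection.riemann, bergmanConnection_nabla X ((bergmanConnection E).nabla Y Z),
    bergmanConnection_nabla Y ((bergmanConnection E).nabla X Z),
    (fderiv_bergmanConnection_nabla hz hY hZ _).2, (fderiv_bergmanConnection_nabla hz hX hZ _).2,
    hs]
  simp only [bergmanConnection_nabla, VectorField.lieBracket, map_sub,
    bergmanGamma, bergmanHerm, inner_add_right, inner_sub_right, inner_smul_right]
  -- The derivatives of the fields cancel; the terms `⟨z, ·⟩⟨z, ·⟩ / ρ²` from the derivative of `Γ`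
  -- cancel against those from `Γ(X, Γ(Y, Z)) - Γ(Y, Γ(X, Z))`.
  match_scalars <;> (field_simp; try ring)

/-- Levi-Civita connections of the Bergman metric have the same curvature. -/
theorem IsLeviCivitaOn.riemann_eq {cov : Connection E}
    (h : IsLeviCivitaOn (Metric.ball (0 : E) 1) (fun z u v => 4 * (bergmanHerm z u v).re) cov)
    {X Y Z : E → E} {z : E} (hz : z ∈ Metric.ball (0 : E) 1)
    (hX : DifferentiableAt ℝ X z) (hY : DifferentiableAt ℝ Y z) (hZ : ContDiffAt ℝ 2 Z z) :
    cov.riemann X Y Z z = (bergmanConnection E).riemann X Y Z z := by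
  have key (X : E → E) {Y : E → E} {z : E} (hz : z ∈ Metric.ball (0 : E) 1)
      (hY : DifferentiableAt ℝ Y z) : cov.nabla X Y z = (bergmanConnection E).nabla X Y z := by
    refine h.nabla_eq isLeviCivitaOn_bergmanConnection (fun z u v => ?_) (fun z u v w => ?_)
      (fun z hz u hu => ?_) X hz hY
    · rw [← conj_bergmanHerm, Complex.conj_re]
    · rw [bergmanHerm_sub_left, Complex.sub_re, mul_sub]
    · by_contra hu0
      have := bergmanHerm_self_pos hz hu0
      linarith
  have hZ1 : DifferentiableAt ℝ Z z := hZ.differentiableAt (by norm_num)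
  -- The outer derivative sees the inner one near `z`, so agreement is needed on a neighbourhood.
  have hev : ∀ᶠ x in nhds z, DifferentiableAt ℝ Z x ∧ x ∈ Metric.ball (0 : E) 1 :=
    ((hZ.eventually (by simp)).mono fun x hx => hx.differentiableAt (by norm_num)).and
      (Metric.isOpen_ball.mem_nhds hz)
  have key2 {X Y : E → E} (hY : DifferentiableAt ℝ Y z) :
      cov.nabla X (cov.nabla Y Z) z =
        (bergmanConnection E).nabla X ((bergmanConnection E).nabla Y Z) z := by
    have he : cov.nabla Y Z =ᶠ[nhds z] (bergmanConnection E).nabla Y Z :=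
      hev.mono fun x hx => key Y hx.2 hx.1
    rw [key X hz ((fderiv_bergmanConnection_nabla hz hY hZ 0).1.congr_of_eventuallyEq he),
      bergmanConnection_nabla, bergmanConnection_nabla, he.fderiv_eq, he.eq_of_nhds]
  rw [Connection.riemann, Connection.riemann, key2 hY, key2 hX, key _ hz hZ1]

end Connection

/-! ### Bases of real planes -/

section Plane

variable {E : Type*} [NormedAddCommGroup E] [NormedSpace ℝ E]

theorem exists_span_pair_of_finrank_eq_two {S : Submodule ℝ E} (hS : Module.finrank ℝ S = 2) :
    ∃ u v : E, LinearIndependent ℝ ![u, v] ∧ S = Submodule.span ℝ {u, v} := by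
  have : Module.Finite ℝ S := Module.finite_of_finrank_eq_succ hS
  let b := Module.finBasisOfFinrankEq ℝ S hS
  refine ⟨b 0, b 1, ?_, ?_⟩
  · refine LinearIndependent.pair_iff.2 fun s t hst => ?_
    have h := Fintype.linearIndependent_iff.1 b.linearIndependent ![s, t] (Subtype.ext (by
      simpa [Fin.sum_univ_two] using hst))
    exact ⟨h 0, h 1⟩
  · have h := congrArg (Submodule.map S.subtype) b.span_eq
    rw [Submodule.map_span, Submodule.map_top, Submodule.range_subtype] at h
    refine h.symm.trans (congrArg _ ?_)
    ext x
    simp [Fin.exists_fin_two, eq_comm]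

theorem finrank_span_pair {u v : E} (h : LinearIndependent ℝ ![u, v]) :
    Module.finrank ℝ (Submodule.span ℝ {u, v}) = 2 := by
  have := finrank_span_eq_card h
  rwa [Matrix.range_cons, Matrix.range_cons, Matrix.range_empty, Set.union_empty,
    Set.singleton_union, Fintype.card_fin] at this

end Plane

/-! ### The curvature function: basis independence, bounds and equality cases -/

section SectionalCurvature

variable {E : Type*} [NormedAddCommGroup E] [InnerProductSpace ℂ E] {z : E}

/-- If the Gram determinant were not positive, the Lagrange identity would force `Im H(u,v) = 0` and
`H(v,v) u = H(u,v) v`, a real linear relation. -/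
theorem bergmanHerm_gram_pos (hz : z ∈ Metric.ball (0 : E) 1) [NormedSpace ℝ E]
    [IsScalarTower ℝ ℂ E] {u v : E} (h : LinearIndependent ℝ ![u, v]) :
    0 < (bergmanHerm z u u).re * (bergmanHerm z v v).re - (bergmanHerm z u v).re ^ 2 := by
  have hv : v ≠ 0 := h.ne_zero 1
  have hvp := bergmanHerm_self_pos hz hv
  by_contra hle
  have h1 := bergmanHerm_gram z u v
  have h2 := bergmanHerm_self_nonneg hz (bergmanHerm z v v • u - bergmanHerm z u v • v)
  rw [← h1] at h2
  have h3 := nonneg_of_mul_nonneg_right h2 hvp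
  have him : (bergmanHerm z u v).im = 0 := by
    have : (bergmanHerm z u v).im ^ 2 ≤ 0 := by linarith
    exact pow_eq_zero_iff two_ne_zero |>.1 (le_antisymm this (sq_nonneg _))
  have h4 : bergmanHerm z v v • u - bergmanHerm z u v • v = 0 := by
    by_contra hne
    have := bergmanHerm_self_pos hz hne
    rw [← h1] at this
    have := (mul_pos_iff_of_pos_left hvp).1 this
    nlinarith
  have e1 : bergmanHerm z v v = algebraMap ℝ ℂ (bergmanHerm z v v).re :=
    Complex.ext rfl (by simp [bergmanHerm_self_im])
  have e2 : bergmanHerm z u v = algebraMap ℝ ℂ (bergmanHerm z u v).re :=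
    Complex.ext rfl (by simp [him])
  rw [e1, e2, algebraMap_smul, algebraMap_smul] at h4
  have := LinearIndependent.pair_iff.1 h (bergmanHerm z v v).re (-(bergmanHerm z u v).re)
    (by rw [neg_smul, ← sub_eq_add_neg, h4])
  exact hvp.ne' this.1

theorem bergmanHerm_im_sq_le (hz : z ∈ Metric.ball (0 : E) 1) (u v : E) :
    (bergmanHerm z u v).im ^ 2 ≤
      (bergmanHerm z u u).re * (bergmanHerm z v v).re - (bergmanHerm z u v).re ^ 2 := by
  rcases eq_or_ne v 0 with rfl | hv
  · simp [bergmanHerm]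
  have h2 := bergmanHerm_self_nonneg hz (bergmanHerm z v v • u - bergmanHerm z u v • v)
  rw [← bergmanHerm_gram z u v] at h2
  linarith [nonneg_of_mul_nonneg_right h2 (bergmanHerm_self_pos hz hv)]

/-- The equality case of the Cauchy-Schwarz inequality. -/
theorem bergmanHerm_im_sq_eq_iff (hz : z ∈ Metric.ball (0 : E) 1) (u : E) {v : E} (hv : v ≠ 0) :
    (bergmanHerm z u v).im ^ 2 =
      (bergmanHerm z u u).re * (bergmanHerm z v v).re - (bergmanHerm z u v).re ^ 2 ↔
    ∃ c : ℂ, u = c • v := by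
  have hvp := bergmanHerm_self_pos hz hv
  have h1 := bergmanHerm_gram z u v
  constructor
  · intro h
    have h4 : bergmanHerm z v v • u - bergmanHerm z u v • v = 0 := by
      by_contra hne
      have := bergmanHerm_self_pos hz hne
      rw [← h1, ← h, sub_self, mul_zero] at this
      exact this.false
    have hne : bergmanHerm z v v ≠ 0 := fun h0 => by simp [h0] at hvp
    refine ⟨(bergmanHerm z v v)⁻¹ * bergmanHerm z u v, ?_⟩
    rw [mul_smul, ← sub_eq_zero.1 h4, smul_smul, inv_mul_cancel₀ hne, one_smul]
  · rintro ⟨c, rfl⟩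
    have hi := bergmanHerm_self_im z v
    simp only [bergmanHerm_smul_left, bergmanHerm_smul_right, Complex.mul_re, Complex.mul_im,
      Complex.conj_re, Complex.conj_im, hi]
    ring

/-- The sectional curvature of the plane spanned by `u` and `v`. -/
def bergmanCurvature (z u v : E) : ℝ :=
  -(1 / 4) * (1 + 3 * (bergmanHerm z u v).im ^ 2 /
    ((bergmanHerm z u u).re * (bergmanHerm z v v).re - (bergmanHerm z u v).re ^ 2))

theorem bergmanHerm_add_right (z u v w : E) :
    bergmanHerm z u (v + w) = bergmanHerm z u v + bergmanHerm z u w := by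
  simp only [bergmanHerm, inner_add_left]
  ring

variable [NormedSpace ℝ E] [IsScalarTower ℝ ℂ E]

theorem bergmanHerm_real_smul_left (z u v : E) (r : ℝ) :
    bergmanHerm z (r • u) v = r * bergmanHerm z u v := by
  rw [← algebraMap_smul ℂ r u, bergmanHerm_smul_left]
  rfl

theorem bergmanHerm_real_smul_right (z u v : E) (r : ℝ) :
    bergmanHerm z u (r • v) = r * bergmanHerm z u v := by
  rw [← algebraMap_smul ℂ r v, bergmanHerm_smul_right]
  simp

/-- `Im H` is an alternating real bilinear form, so it scales by the determinant. -/
theorem bergmanHerm_im_basis_change (z u v : E) (a b c d : ℝ) :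
    (bergmanHerm z (a • u + b • v) (c • u + d • v)).im =
      (a * d - b * c) * (bergmanHerm z u v).im := by
  have hu := bergmanHerm_self_im z u
  have hv := bergmanHerm_self_im z v
  simp only [bergmanHerm_add_left, bergmanHerm_add_right, bergmanHerm_real_smul_left,
    bergmanHerm_real_smul_right, ← conj_bergmanHerm z u v, Complex.add_im, Complex.mul_im,
    Complex.ofReal_re, Complex.ofReal_im, Complex.conj_re, Complex.conj_im, hu, hv]
  ring

/-- Both `(Im H)²` and the Gram determinant scale by the square of the determinant. -/
theorem bergmanCurvature_basis_change (hz : z ∈ Metric.ball (0 : E) 1) {u v : E}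
    (h : LinearIndependent ℝ ![u, v]) (a b c d : ℝ)
    (h' : LinearIndependent ℝ ![a • u + b • v, c • u + d • v]) :
    bergmanCurvature z (a • u + b • v) (c • u + d • v) = bergmanCurvature z u v := by
  have h1 := bergmanHerm_gram_pos hz h
  have h2 := bergmanHerm_gram_pos hz h'
  have hu := bergmanHerm_self_im z u
  have hv := bergmanHerm_self_im z v
  have hvu := conj_bergmanHerm z u v
  have hgram : (bergmanHerm z (a • u + b • v) (a • u + b • v)).re *
      (bergmanHerm z (c • u + d • v) (c • u + d • v)).re -
      (bergmanHerm z (a • u + b • v) (c • u + d • v)).re ^ 2 =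
      (a * d - b * c) ^ 2 * ((bergmanHerm z u u).re * (bergmanHerm z v v).re -
        (bergmanHerm z u v).re ^ 2) := by
    simp only [bergmanHerm_add_left, bergmanHerm_add_right, bergmanHerm_real_smul_left,
      bergmanHerm_real_smul_right, ← hvu, Complex.add_re, Complex.mul_im, Complex.ofReal_re,
      Complex.ofReal_im, Complex.conj_re, Complex.conj_im, Complex.mul_re, hu, hv, Complex.add_im]
    ring
  rw [hgram] at h2
  have hd : a * d - b * c ≠ 0 := fun h0 => by simp [h0] at h2
  rw [bergmanCurvature, hgram, bergmanHerm_im_basis_change, bergmanCurvature, mul_pow, mul_left_comm,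
    mul_div_mul_left _ _ (pow_ne_zero 2 hd)]

theorem bergmanCurvature_bounds (hz : z ∈ Metric.ball (0 : E) 1) {u v : E}
    (h : LinearIndependent ℝ ![u, v]) :
    -1 ≤ bergmanCurvature z u v ∧ bergmanCurvature z u v ≤ -1 / 4 := by
  have h1 := bergmanHerm_gram_pos hz h
  have h2 := bergmanHerm_im_sq_le hz u v
  have h3 : 3 * (bergmanHerm z u v).im ^ 2 / ((bergmanHerm z u u).re * (bergmanHerm z v v).re -
        (bergmanHerm z u v).re ^ 2) ≤ 3 := by
    rw [div_le_iff₀ h1]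
    linarith
  have h4 : 0 ≤ 3 * (bergmanHerm z u v).im ^ 2 / ((bergmanHerm z u u).re * (bergmanHerm z v v).re -
        (bergmanHerm z u v).re ^ 2) := by positivity
  rw [bergmanCurvature]
  constructor <;> linarith

theorem bergmanCurvature_eq_neg_one_iff (hz : z ∈ Metric.ball (0 : E) 1) {u v : E}
    (h : LinearIndependent ℝ ![u, v]) :
    bergmanCurvature z u v = -1 ↔ ∃ c : ℂ, u = c • v := by
  have h1 := bergmanHerm_gram_pos hz h
  rw [← bergmanHerm_im_sq_eq_iff hz u (v := v) (h.ne_zero 1), bergmanCurvature]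
  constructor
  · intro h0
    field_simp at h0
    linarith
  · intro h0
    rw [h0]
    field_simp
    norm_num

theorem bergmanCurvature_eq_neg_quarter_iff (hz : z ∈ Metric.ball (0 : E) 1) {u v : E}
    (h : LinearIndependent ℝ ![u, v]) :
    bergmanCurvature z u v = -1 / 4 ↔ (bergmanHerm z u v).im = 0 := by
  have h1 := bergmanHerm_gram_pos hz h
  rw [bergmanCurvature]
  constructor
  · intro h0
    field_simp at h0
    have : (bergmanHerm z u v).im ^ 2 = 0 := by linarith
    exact pow_eq_zero_iff two_ne_zero |>.1 this
  · intro h0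
    rw [h0]
    norm_num

/-- A real plane is complex if and only if any basis of it is complex linearly dependent. -/
theorem forall_I_smul_mem_span_pair_iff {u v : E} (h : LinearIndependent ℝ ![u, v]) :
    (∀ w ∈ Submodule.span ℝ {u, v}, Complex.I • w ∈ Submodule.span ℝ {u, v}) ↔
      ∃ c : ℂ, u = c • v := by
  have hR (r : ℝ) (w : E) : r • w = (r : ℂ) • w := (algebraMap_smul ℂ r w).symm
  constructor
  · intro hS
    obtain ⟨a, b, hab⟩ := Submodule.mem_span_pair.1
      (hS v (Submodule.subset_span (by simp)))
    -- Otherwise `i v = b v` with `b` real; once `a ≠ 0`, the relation `i v = a u + b v` is solved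
    -- for `u`.
    have ha : a ≠ 0 := by
      rintro rfl
      rw [zero_smul, zero_add, hR] at hab
      have h0 : ((b : ℂ) - Complex.I) • v = 0 := by rw [sub_smul, hab, sub_self]
      rcases smul_eq_zero.1 h0 with h0 | h0
      · simpa using congrArg Complex.im h0
      · exact h.ne_zero 1 h0
    refine ⟨(a : ℂ)⁻¹ * (Complex.I - b), ?_⟩
    rw [mul_smul, sub_smul, ← hab, hR, hR, add_sub_cancel_right, smul_smul,
      inv_mul_cancel₀ (Complex.ofReal_ne_zero.2 ha), one_smul]
  · rintro ⟨c, rfl⟩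
    have hc : c.im ≠ 0 := by
      intro hc
      have h0 := LinearIndependent.pair_iff.1 h 1 (-c.re) (by
        rw [one_smul, hR]
        nth_rw 1 [← Complex.re_add_im c]
        rw [hc]
        push_cast
        module)
      exact one_ne_zero h0.1
    have hcc : (c.im : ℂ) ≠ 0 := Complex.ofReal_ne_zero.2 hc
    have hI2 : Complex.I ^ 2 = -1 := Complex.I_sq
    have hc' : c = c.re + c.im * Complex.I := (Complex.re_add_im c).symm
    intro w hw
    obtain ⟨a, b, rfl⟩ := Submodule.mem_span_pair.1 hw
    -- Real and imaginary parts of `s c + t = i (a c + b)`, solved for real `s`, `t`.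
    refine Submodule.mem_span_pair.2
      ⟨(a * c.re + b) / c.im, -a * c.im - c.re * (a * c.re + b) / c.im, ?_⟩
    simp only [hR, smul_smul, ← add_smul]
    congr 1
    apply Complex.ext
    · simp
      field_simp
      ring
    · simp
      field_simp

end SectionalCurvature

/-! ### Sectional curvature of an arbitrary Levi-Civita connection -/

section SectionalCurvature

variable {E : Type*} [NormedAddCommGroup E] [InnerProductSpace ℂ E] [NormedSpace ℝ E]
  [IsScalarTower ℝ ℂ E]

theorem IsLeviCivitaOn.sectionalCurvature_eq {cov : Connection E}
    (h : IsLeviCivitaOn (Metric.ball (0 : E) 1) (fun z u v => 4 * (bergmanHerm z u v).re) cov)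
    {z : E} (hz : z ∈ Metric.ball (0 : E) 1) {u v : E} (huv : LinearIndependent ℝ ![u, v])
    {X Y Z : E → E} (hX : DifferentiableAt ℝ X z) (hY : DifferentiableAt ℝ Y z)
    (hZ : ContDiffAt ℝ 2 Z z) (hXu : X z = u) (hYv : Y z = v) (hZv : Z z = v) :
    4 * (bergmanHerm z (cov.riemann X Y Z z) u).re /
      (4 * (bergmanHerm z u u).re * (4 * (bergmanHerm z v v).re) -
        (4 * (bergmanHerm z u v).re) ^ 2) = bergmanCurvature z u v := by
  have hpos := bergmanHerm_gram_pos hz huv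
  have hu := bergmanHerm_self_im z u
  have hv := bergmanHerm_self_im z v
  have hden : 4 * (bergmanHerm z u u).re * (4 * (bergmanHerm z v v).re) -
      (4 * (bergmanHerm z u v).re) ^ 2 =
      16 * ((bergmanHerm z u u).re * (bergmanHerm z v v).re - (bergmanHerm z u v).re ^ 2) := by
    ring
  rw [h.riemann_eq hz hX hY hZ, riemann_bergmanConnection hz hX hY hZ, hXu, hYv, hZv,
    bergmanHerm_sub_left, bergmanHerm_add_left, bergmanHerm_smul_left, bergmanHerm_smul_left,
    bergmanHerm_smul_left, ← conj_bergmanHerm z u v, hden, bergmanCurvature]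
  simp only [Complex.mul_re, Complex.add_re, Complex.sub_re, Complex.sub_im, Complex.conj_re,
    Complex.conj_im, hu, hv]
  generalize hD : (bergmanHerm z u u).re * (bergmanHerm z v v).re - (bergmanHerm z u v).re ^ 2 = D
    at hpos ⊢
  field_simp
  rw [← hD]
  ring

/-- The real planes have a well-defined sectional curvature. -/
theorem IsLeviCivitaOn.isSectionalCurvature_iff {cov : Connection E}
    (h : IsLeviCivitaOn (Metric.ball (0 : E) 1) (fun z u v => 4 * (bergmanHerm z u v).re) cov)
    {z : E} (hz : z ∈ Metric.ball (0 : E) 1) {u v : E} (huv : LinearIndependent ℝ ![u, v])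
    (κ : ℝ) :
    IsSectionalCurvature (Metric.ball (0 : E) 1) (fun z u v => 4 * (bergmanHerm z u v).re) cov z
      (Submodule.span ℝ {u, v}) κ ↔ κ = bergmanCurvature z u v := by
  constructor
  · intro hκ
    -- Constant extensions of `u` and `v` already determine `κ`.
    have h1 := hκ u (Submodule.subset_span (by simp)) v (Submodule.subset_span (by simp)) huv
      (fun _ => u) (fun _ => v) (fun _ => v) contDiffOn_const contDiffOn_const contDiffOn_const
      rfl rfl rfl
    rw [← h1]
    exact h.sectionalCurvature_eq hz huv (by fun_prop) (by fun_prop) contDiffAt_const rfl rfl rfl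
  · rintro rfl u' hu' v' hv' huv' X Y Z hX hY hZ hXu hYv hZv
    have hnhds := Metric.isOpen_ball.mem_nhds hz
    have hκ := h.sectionalCurvature_eq hz huv' ((hX.contDiffAt hnhds).differentiableAt (by simp))
      ((hY.contDiffAt hnhds).differentiableAt (by simp))
      ((hZ.contDiffAt hnhds).of_le (WithTop.coe_le_coe.2 le_top)) hXu hYv hZv
    obtain ⟨a, b, rfl⟩ := Submodule.mem_span_pair.1 hu'
    obtain ⟨c, d, rfl⟩ := Submodule.mem_span_pair.1 hv'
    rw [← bergmanCurvature_basis_change hz huv a b c d huv', ← hκ]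

theorem linearIndependent_pair_I_smul {u : E} (hu : u ≠ 0) :
    LinearIndependent ℝ ![Complex.I • u, u] := by
  refine LinearIndependent.pair_iff.2 fun s t hst => ?_
  rw [← algebraMap_smul ℂ s, ← algebraMap_smul ℂ t u, smul_smul, ← add_smul] at hst
  have h0 := (smul_eq_zero.1 hst).resolve_right hu
  exact ⟨by simpa using congrArg Complex.im h0, by simpa using congrArg Complex.re h0⟩

theorem linearIndependent_pair_of_bergmanHerm_eq_zero {z : E} (hz : z ∈ Metric.ball (0 : E) 1)
    {u v : E} (hu : u ≠ 0) (hv : v ≠ 0) (h : bergmanHerm z u v = 0) :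
    LinearIndependent ℝ ![u, v] := by
  have hvu : bergmanHerm z v u = 0 := by rw [← conj_bergmanHerm, h, map_zero]
  have h0 (w : E) : bergmanHerm z 0 w = 0 := by simp [bergmanHerm]
  have hne {w : E} (hw : w ≠ 0) : bergmanHerm z w w ≠ 0 := fun h0 => by
    simpa [h0] using bergmanHerm_self_pos hz hw
  refine LinearIndependent.pair_iff.2 fun s t hst => ⟨?_, ?_⟩
  · have h1 := congrArg (fun w => bergmanHerm z w u) hst
    simpa [bergmanHerm_add_left, bergmanHerm_real_smul_left, hvu, hne hu, h0] using h1
  · have h1 := congrArg (fun w => bergmanHerm z w v) hst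
    simpa [bergmanHerm_add_left, bergmanHerm_real_smul_left, h, hne hv, h0] using h1

end SectionalCurvature

/-! ### The ball model in coordinates -/

section ComplexHyperbolicSpace

variable {n : ℕ}

theorem hermForm_affineLift (u v : EuclideanSpace ℂ (Fin n)) (s t : ℂ) :
    hermForm (affineLift u s) (affineLift v t) = inner ℂ v u - s * starRingEnd ℂ t := by
  simp [hermForm, affineLift, PiLp.inner_apply]

theorem bergmanMetric_eq :
    (bergmanMetric : EuclideanSpace ℂ (Fin n) → _ → _ → ℝ) =
      fun z u v => 4 * (bergmanHerm z u v).re := by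
  funext z u v
  have hρ : inner ℂ z z - 1 * starRingEnd ℂ 1 = -bergmanRho z := by
    simp [bergmanRho]
  have hcast : bergmanRho z = ((1 - ‖z‖ ^ 2 : ℝ) : ℂ) := bergmanRho_eq z
  simp only [bergmanMetric, hermForm_affineLift, Matrix.det_fin_two_of, hρ, zero_mul, mul_zero,
    map_zero, sub_zero]
  rw [bergmanHerm, hcast]
  generalize 1 - ‖z‖ ^ 2 = r
  -- On the unit sphere both sides are `0` by the convention for division by zero, so the equality
  -- holds for all `z`.
  rcases eq_or_ne r 0 with rfl | hr
  · simp
  rw [← Complex.ofReal_pow, Complex.add_re, Complex.div_ofReal_re, Complex.div_ofReal_re]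
  simp only [Complex.neg_re, Complex.ofReal_re, Complex.sub_re, neg_mul, Complex.re_ofReal_mul,
    neg_sq]
  field_simp
  ring

theorem complexHyperbolicSpace_eq_ball :
    complexHyperbolicSpace n = Metric.ball (0 : EuclideanSpace ℂ (Fin n)) 1 := by
  ext w
  rw [mem_ball_zero_iff]
  constructor
  · rintro ⟨z, hz, rfl⟩
    have hsum : (hermForm z z).re = ∑ i : Fin n, ‖z i.castSucc‖ ^ 2 - ‖z (Fin.last n)‖ ^ 2 := by
      simp only [hermForm, Complex.mul_conj', ← Complex.ofReal_pow, Complex.sub_re,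
        Complex.re_sum, Complex.ofReal_re]
    rw [Set.mem_ofPred_eq, hsum] at hz
    -- Negativity of the form forces a nonzero last coordinate.
    have hpos : 0 < ‖z (Fin.last n)‖ ^ 2 :=
      lt_of_le_of_lt (Finset.sum_nonneg fun _ _ => sq_nonneg _) (sub_neg.1 hz)
    rw [← sq_lt_one_iff₀ (norm_nonneg _), EuclideanSpace.norm_sq_eq]
    simp only [projMap, norm_div, div_pow]
    rw [← Finset.sum_div, div_lt_one hpos]
    linarith
  · intro hw
    refine ⟨affineLift w 1, ?_, ?_⟩
    · rw [Set.mem_ofPred_eq, hermForm_affineLift, inner_self_eq_norm_sq_to_K]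
      have : ‖w‖ ^ 2 < 1 := (sq_lt_one_iff₀ (norm_nonneg _)).2 hw
      simp [← Complex.ofReal_pow, this]
    · ext i
      simp [projMap, affineLift]

theorem isTotallyReal_span_pair_iff (z u v : EuclideanSpace ℂ (Fin n)) :
    IsTotallyReal z (Submodule.span ℝ {u, v}) ↔ (bergmanHerm z u v).im = 0 := by
  have hI (a b : EuclideanSpace ℂ (Fin n)) :
      bergmanMetric z a (Complex.I • b) = 4 * (bergmanHerm z a b).im := by
    rw [bergmanMetric_eq]
    simp [bergmanHerm_smul_right]
  simp only [IsTotallyReal, hI]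
  constructor
  · intro h
    simpa using h u (Submodule.subset_span (by simp)) v (Submodule.subset_span (by simp))
  · intro h a ha b hb
    obtain ⟨a, c, rfl⟩ := Submodule.mem_span_pair.1 ha
    obtain ⟨b, d, rfl⟩ := Submodule.mem_span_pair.1 hb
    rw [bergmanHerm_im_basis_change, h, mul_zero, mul_zero]

/-- Gram-Schmidt without division, applied to two standard basis vectors; the `i`-th coordinate
`H(v,v)` shows that the result is nonzero. -/
theorem exists_bergmanHerm_eq_zero (hn : 2 ≤ n) {z : EuclideanSpace ℂ (Fin n)}
    (hz : z ∈ Metric.ball (0 : EuclideanSpace ℂ (Fin n)) 1) :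
    ∃ u v : EuclideanSpace ℂ (Fin n), u ≠ 0 ∧ v ≠ 0 ∧ bergmanHerm z u v = 0 := by
  let i : Fin n := ⟨0, by lia⟩
  let j : Fin n := ⟨1, by lia⟩
  have hij : i ≠ j := by simp [i, j]
  let e : EuclideanSpace ℂ (Fin n) := EuclideanSpace.single i 1
  let v : EuclideanSpace ℂ (Fin n) := EuclideanSpace.single j 1
  have hv : v ≠ 0 := by simp [v]
  have hvv : bergmanHerm z v v ≠ 0 := fun h0 => by
    simpa [h0] using bergmanHerm_self_pos hz hv
  refine ⟨bergmanHerm z v v • e - bergmanHerm z e v • v, v, fun h => hvv ?_, hv, ?_⟩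
  · simpa [e, v, hij] using congrArg (fun w : EuclideanSpace ℂ (Fin n) => w i) h
  · rw [bergmanHerm_sub_left, bergmanHerm_smul_left, bergmanHerm_smul_left]
    ring

end ComplexHyperbolicSpace

end

/-! ### Curvature pinching for complex hyperbolic space -/

theorem theorem1 (n : ℕ) :
    (∃ cov : Connection (EuclideanSpace ℂ (Fin n)),
      IsLeviCivitaOn (complexHyperbolicSpace n) bergmanMetric cov) ∧
    ∀ cov : Connection (EuclideanSpace ℂ (Fin n)),
      IsLeviCivitaOn (complexHyperbolicSpace n) bergmanMetric cov →
      -- the curvature of every tangent plane is pinched between -1 and -1/4, with equality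
      -- exactly for complex lines and for totally real planes, respectively
      (∀ z ∈ complexHyperbolicSpace n, ∀ S : Submodule ℝ (EuclideanSpace ℂ (Fin n)),
        Module.finrank ℝ S = 2 →
        ∃ κ : ℝ, IsSectionalCurvature (complexHyperbolicSpace n) bergmanMetric cov z S κ ∧
          -1 ≤ κ ∧ κ ≤ -1 / 4 ∧
          (κ = -1 ↔ IsComplexSubspace S) ∧ (κ = -1 / 4 ↔ IsTotallyReal z S)) ∧
      -- in complex dimension at least two both bounds are attained at every point
      -- and the curvature is not constant
      (2 ≤ n →
        (∀ z ∈ complexHyperbolicSpace n,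
          (∃ S : Submodule ℝ (EuclideanSpace ℂ (Fin n)),
            Module.finrank ℝ S = 2 ∧ IsComplexSubspace S ∧
            IsSectionalCurvature (complexHyperbolicSpace n) bergmanMetric cov z S (-1)) ∧
          (∃ S : Submodule ℝ (EuclideanSpace ℂ (Fin n)),
            Module.finrank ℝ S = 2 ∧ IsTotallyReal z S ∧
            IsSectionalCurvature (complexHyperbolicSpace n) bergmanMetric cov z S (-1 / 4))) ∧
        ¬ ∃ κ : ℝ, ∀ z ∈ complexHyperbolicSpace n,
          ∀ S : Submodule ℝ (EuclideanSpace ℂ (Fin n)), Module.finrank ℝ S = 2 →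
            IsSectionalCurvature (complexHyperbolicSpace n) bergmanMetric cov z S κ) := by
  rw [complexHyperbolicSpace_eq_ball]
  have hiff (cov : Connection (EuclideanSpace ℂ (Fin n)))
      (h : IsLeviCivitaOn (Metric.ball 0 1) bergmanMetric cov) {z u v : EuclideanSpace ℂ (Fin n)}
      (hz : z ∈ Metric.ball 0 1) (huv : LinearIndependent ℝ ![u, v]) (κ : ℝ) :
      IsSectionalCurvature (Metric.ball 0 1) bergmanMetric cov z (Submodule.span ℝ {u, v}) κ ↔
        κ = bergmanCurvature z u v := by
    rw [bergmanMetric_eq] at h ⊢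
    exact h.isSectionalCurvature_iff hz huv κ
  refine ⟨⟨bergmanConnection _, ?_⟩, fun cov h => ⟨fun z hz S hS => ?_, fun hn => ?_⟩⟩
  · rw [bergmanMetric_eq]
    exact isLeviCivitaOn_bergmanConnection
  · obtain ⟨u, v, huv, rfl⟩ := exists_span_pair_of_finrank_eq_two hS
    obtain ⟨h1, h2⟩ := bergmanCurvature_bounds hz huv
    refine ⟨bergmanCurvature z u v, (hiff cov h hz huv _).2 rfl, h1, h2, ?_, ?_⟩
    · rw [bergmanCurvature_eq_neg_one_iff hz huv, IsComplexSubspace,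
        forall_I_smul_mem_span_pair_iff huv]
    · rw [bergmanCurvature_eq_neg_quarter_iff hz huv, isTotallyReal_span_pair_iff]
  -- From an `H`-orthogonal pair `u`, `v`: the complex line spanned by `i u`, `u` and the totally
  -- real plane spanned by `u`, `v`.
  · have hplanes (z : EuclideanSpace ℂ (Fin n)) (hz : z ∈ Metric.ball 0 1) :
        ∃ u v u' v' : EuclideanSpace ℂ (Fin n), LinearIndependent ℝ ![u, v] ∧
          LinearIndependent ℝ ![u', v'] ∧ (∃ c : ℂ, u = c • v) ∧ (bergmanHerm z u' v').im = 0 := by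
      obtain ⟨u, v, hu, hv, huv⟩ := exists_bergmanHerm_eq_zero hn hz
      exact ⟨Complex.I • u, u, u, v, linearIndependent_pair_I_smul hu,
        linearIndependent_pair_of_bergmanHerm_eq_zero hz hu hv huv, ⟨_, rfl⟩, by simp [huv]⟩
    constructor
    · intro z hz
      obtain ⟨u, v, u', v', huv, huv', hc, hr⟩ := hplanes z hz
      refine ⟨⟨_, finrank_span_pair huv, (forall_I_smul_mem_span_pair_iff huv).2 hc,
        (hiff cov h hz huv _).2 ?_⟩, ⟨_, finrank_span_pair huv',
        (isTotallyReal_span_pair_iff z u' v').2 hr, (hiff cov h hz huv' _).2 ?_⟩⟩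
      · exact ((bergmanCurvature_eq_neg_one_iff hz huv).2 hc).symm
      · exact ((bergmanCurvature_eq_neg_quarter_iff hz huv').2 hr).symm
    · rintro ⟨κ, hκ⟩
      have hz : (0 : EuclideanSpace ℂ (Fin n)) ∈ Metric.ball 0 1 := by simp
      obtain ⟨u, v, u', v', huv, huv', hc, hr⟩ := hplanes 0 hz
      have h1 := (hiff cov h hz huv κ).1 (hκ 0 hz _ (finrank_span_pair huv))
      have h2 := (hiff cov h hz huv' κ).1 (hκ 0 hz _ (finrank_span_pair huv'))
      rw [(bergmanCurvature_eq_neg_one_iff hz huv).2 hc] at h1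
      rw [(bergmanCurvature_eq_neg_quarter_iff hz huv').2 hr, h1] at h2
      norm_num at h2
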